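/- Graphs are finite, have at least one vertex, may have parallel edges, and have no loops. A unique shortest path in a graph $G$ is a path $P$ (a single vertex is allowed) such that every other path of $G$ with the same initial and final vertex is strictly longer; paths with different edge sequences count as different, even if their vertex sequences agree. A parade in $G$ is a unique shortest path with the largest possible number of vertices. The spectator number of $G$ is the number of vertices of $G$ outside a parade. A minor of a graph $H$ is a graph isomorphic to one obtained from $H$ by a (possibly empty) sequence of the following operations: deleting an isolated vertex, deleting an edge, contracting an edge that has no other edge in parallel with it. The spectator floor of $G$ is the minimum of the spectator numbers of all graphs $H$ of which $G$ is a minor. For $p\ge 2$ and $m\ge 1$, an $m$-saturated crowded $p$-parade is a graph $G$ that has a parade $P$ with $p$ vertices such that (i) every vertex outside $P$ is adjacent to exactly two vertices of $P$, and those two are adjacent to each other; (ii) any two distinct vertices outside $P$ that are adjacent to a common vertex of $P$ are adjacent to each other; (iii) every edge of $G$ not in $P$ is one of exactly $m$ edges joining its two ends. An $m$-saturated crowded $1$-parade is a graph in which every pair of distinct vertices is joined by exactly $m$ edges. Theorem. Let $n,m,k$ be integers with $k\ge 0$, and suppose that either $k\le n-2$ and $m\ge 1$, or $k=n-1$ and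 $m\ge 2$. Let $\mathcal C$ be the class of graphs with $n$ vertices, at most $m$ parallel edges between any two vertices, and spectator floor $k$. If $G\in\mathcal C$ is minor maximal in $\mathcal C$ (that is, every graph in $\mathcal C$ of which $G$ is a minor is isomorphic to $G$), then $G$ is an $m$-saturated crowded $(n-k)$-parade. -/

import Mathlib

universe u v

namespace Graph

variable {α : Type u} {β : Type v}

/-- The graphs considered: finite, with at least one vertex, parallel edges allowed, no loops. -/
structure IsFiniteMultigraph (G : Graph α β) : Prop where
  nonempty : G.vertexSet.Nonempty
  finite_vertexSet : G.vertexSet.Finite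
  finite_edgeSet : G.edgeSet.Finite
  loopless : G.Loopless

/-- `p 0, e 0, p 1, e 1, …, e (k - 1), p k` is a walk of length `k`: each edge `e i` has ends
`p i` and `p (i + 1)`. -/
structure IsWalk (G : Graph α β) (k : ℕ) (p : Fin (k + 1) → α) (e : Fin k → β) : Prop where
  vertex_mem : ∀ i, p i ∈ G.vertexSet
  isLink : ∀ i : Fin k, G.IsLink (e i) (p i.castSucc) (p i.succ)

/-- A path is a walk whose vertices are distinct; its order is `k + 1`. -/
structure IsPath (G : Graph α β) (k : ℕ) (p : Fin (k + 1) → α) (e : Fin k → β) : Prop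
    extends G.IsWalk k p e where
  injective : Function.Injective p

/-- A path such that no path with the same endpoints is shorter. -/
structure IsShortestPath (G : Graph α β) (k : ℕ) (p : Fin (k + 1) → α) (e : Fin k → β) : Prop
    extends G.IsPath k p e where
  le_length : ∀ (l : ℕ) (q : Fin (l + 1) → α) (f : Fin l → β), G.IsPath l q f →
    q 0 = p 0 → q (Fin.last l) = p (Fin.last k) → k ≤ l

/-- A shortest path such that every path of the same order with the same endpoints has the same
vertices and the same edges. -/
structure IsUniqueShortestPath (G : Graph α β) (k : ℕ) (p : Fin (k + 1) → α) (e : Fin k → β) :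
    Prop extends G.IsShortestPath k p e where
  unique : ∀ (q : Fin (k + 1) → α) (f : Fin k → β), G.IsPath k q f →
    q 0 = p 0 → q (Fin.last k) = p (Fin.last k) → q = p ∧ f = e

/-- A parade is a unique shortest path of the largest possible order. -/
structure IsParade (G : Graph α β) (k : ℕ) (p : Fin (k + 1) → α) (e : Fin k → β) : Prop
    extends G.IsUniqueShortestPath k p e where
  length_le : ∀ (l : ℕ) (q : Fin (l + 1) → α) (f : Fin l → β),
    G.IsUniqueShortestPath l q f → l ≤ k

/-- The parade number: the largest order of a unique shortest path, that is, the number of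
vertices of any parade. -/
noncomputable def paradeNumber (G : Graph α β) : ℕ :=
  sSup {r | ∃ (k : ℕ) (p : Fin (k + 1) → α) (e : Fin k → β),
    G.IsUniqueShortestPath k p e ∧ r = k + 1}

/-- The spectator number: the number of vertices outside a parade. -/
noncomputable def spectatorNumber (G : Graph α β) : ℕ :=
  G.vertexSet.ncard - G.paradeNumber

open scoped Classical in
/-- The graph obtained by contracting the edge `e` with ends `x` and `y`; the merged vertex is
called `x`. -/
noncomputable def contractEdge (G : Graph α β) (e : β) (x y : α) : Graph α β :=
  (G.deleteEdges {e}).map (fun z => if z = y then x else z)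

/-- `H.IsElementaryMinor K`: the graph `K` is obtained from `H` by deleting an isolated vertex,
deleting an edge, or contracting an edge that has no other edge in parallel with it. -/
inductive IsElementaryMinor (H : Graph α β) : Graph α β → Prop
  | deleteVertex (x : α) (hx : x ∈ H.vertexSet) (hisolated : ∀ e, ¬ H.Inc e x) :
      IsElementaryMinor H (H.deleteVerts {x})
  | deleteEdge (e : β) (he : e ∈ H.edgeSet) :
      IsElementaryMinor H (H.deleteEdges {e})
  | contract (e : β) (x y : α) (he : H.IsLink e x y) (hparallel : ∀ f, H.IsLink f x y → f = e) :
      IsElementaryMinor H (H.contractEdge e x y)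

/-- Isomorphism of multigraphs. -/
def IsIsomorphic {γ δ : Type*} (G : Graph α β) (H : Graph γ δ) : Prop :=
  ∃ (φ : G.vertexSet ≃ H.vertexSet) (ψ : G.edgeSet ≃ H.edgeSet),
    ∀ (e : G.edgeSet) (x y : G.vertexSet), G.IsLink e x y ↔ H.IsLink (ψ e) (φ x) (φ y)

/-- `G.IsMinorOf H`: up to isomorphism, `G` is obtained from `H` by a (possibly empty) sequence
of elementary minor operations. -/
def IsMinorOf {γ δ : Type*} (G : Graph α β) (H : Graph γ δ) : Prop :=
  ∃ K : Graph γ δ, Relation.ReflTransGen IsElementaryMinor H K ∧ G.IsIsomorphic K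

/-- The spectator floor: the minimum spectator number of a graph `H` of which `G` is a minor. -/
noncomputable def spectatorFloor (G : Graph α β) : ℕ :=
  sInf {s | ∃ (γ : Type u) (δ : Type v) (H : Graph γ δ),
    H.IsFiniteMultigraph ∧ G.IsMinorOf H ∧ s = H.spectatorNumber}

/-- The class of graphs with `n` vertices, at most `m` parallel edges between any given vertices,
and spectator floor `k`. -/
structure InClass (G : Graph α β) (n m k : ℕ) : Prop where
  isFiniteMultigraph : G.IsFiniteMultigraph
  ncard_vertexSet : G.vertexSet.ncard = n
  ncard_parallel_le : ∀ x y, {e | G.IsLink e x y}.ncard ≤ m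
  spectatorFloor_eq : G.spectatorFloor = k

/-- `G` lies in the class, and is not a proper minor of a graph in the class: every graph in the
class that has `G` as a minor is isomorphic to `G`. -/
def IsMinorMaximal (G : Graph α β) (n m k : ℕ) : Prop :=
  G.InClass n m k ∧ ∀ (γ : Type u) (δ : Type v) (H : Graph γ δ),
    H.InClass n m k → G.IsMinorOf H → G.IsIsomorphic H

/-- The path is a parade, every vertex outside it is adjacent to exactly two of its vertices,
which are adjacent to each other, and any two vertices outside it that are adjacent to a common
vertex of the parade are adjacent to each other. -/
structure IsCrowdedAlong (G : Graph α β) (k : ℕ) (p : Fin (k + 1) → α) (e : Fin k → β) : Prop where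
  isParade : G.IsParade k p e
  adj_exactly_two : ∀ w ∈ G.vertexSet, w ∉ Set.range p →
    ∃ x ∈ Set.range p, ∃ y ∈ Set.range p, x ≠ y ∧ G.Adj x y ∧
      ∀ z ∈ Set.range p, G.Adj w z ↔ z = x ∨ z = y
  adj_of_common : ∀ w ∈ G.vertexSet, ∀ w' ∈ G.vertexSet, w ∉ Set.range p → w' ∉ Set.range p →
    w ≠ w' → (∃ z ∈ Set.range p, G.Adj w z ∧ G.Adj w' z) → G.Adj w w'

/-- An `m`-saturated crowded `r`-parade. For `r ≥ 2`: the graph is crowded along a parade with `r`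
vertices, and every edge `f` not in that parade is one of exactly `m` parallel edges. For `r = 1`:
every two distinct vertices are joined by exactly `m` edges. -/
def IsSaturatedCrowdedParade (G : Graph α β) (m r : ℕ) : Prop :=
  (2 ≤ r ∧ ∃ (k : ℕ) (p : Fin (k + 1) → α) (e : Fin k → β), k + 1 = r ∧ G.IsCrowdedAlong k p e ∧
    ∀ f ∉ Set.range e, ∀ x y, G.IsLink f x y → {g | G.IsLink g x y}.ncard = m) ∨
  (r = 1 ∧ ∀ x ∈ G.vertexSet, ∀ y ∈ G.vertexSet, x ≠ y → {g | G.IsLink g x y}.ncard = m)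

end Graph

/-!
A graph `H` with a parade of length `L ≥ 1` and `k` spectators can be drawn along a line: the
vertices of the parade take the even points `0, 2, …, 2 * L` in order, and a spectator takes the
odd point `2 * d - 1`, where `d` is its distance from the start of the parade, replaced by `L` if
it is larger. Since the parade is a unique shortest path, adjacent vertices have positions that
differ by at most `2`, and edges between even points have no parallels
(`IsUniqueShortestPath.exists_isLayout`). Such a drawing is called a *layout* (`IsLayout`).

Having a layout with exactly `k` spectators passes to minors
(`HasSpectators.of_isElementaryMinor`): an operation that removes one vertex can be matched by
shortening the line by one even point. To this end a suitable vertex on an even point is first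
made a spectator (`IsLayout.demote`) so that the deleted vertex is a spectator, or the ends of the
contracted edge are spectators at the same point; if the contracted edge joins two even points,
these are identified (`IsLayout.contract_path`). Hence a graph with spectator floor `k` and
`n ≥ k + 2` vertices has a layout of length `n - k - 1`.

Now add edges to such a graph `G` until all pairs of vertices with positions at most `2` apart are
joined by `m` edges, or by one edge if both positions are even. In the resulting graph the
vertices on the even points form a parade (`IsSaturatedLayout.isParade`): positions change by at
most `2` along an edge, so it is a unique shortest path, and the diameter is `n - k - 1`. Its
spectator number is therefore `k`, and so is its floor, because deleting edges cannot raise the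
floor (`spectatorFloor_le_of_deleteEdges`). By maximality `G` is isomorphic to the graph obtained,
and counting edges shows that no edge was added (`IsMinorMaximal.ncard_eq`). So `G` itself is a
saturated layout, which is a saturated crowded parade.

If `n = k + 1` and `m ≥ 2`, the same argument applies to the graph in which any two vertices are
joined by `m` edges; its unique shortest paths are single vertices.
-/

namespace Graph

variable {α : Type u} {β : Type v} {γ δ ε ζ : Type*}

/-! ### Isomorphism and deletion of edges -/

lemma IsIsomorphic.trans {G : Graph α β} {H : Graph γ δ} {K : Graph ε ζ}
    (h₁ : G.IsIsomorphic H) (h₂ : H.IsIsomorphic K) : G.IsIsomorphic K := by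
  obtain ⟨φ, ψ, h⟩ := h₁
  obtain ⟨φ', ψ', h'⟩ := h₂
  exact ⟨φ.trans φ', ψ.trans ψ', fun e x y => (h e x y).trans (h' _ _ _)⟩

lemma IsIsomorphic.refl (G : Graph α β) : G.IsIsomorphic G :=
  ⟨Equiv.refl _, Equiv.refl _, fun _ _ _ => Iff.rfl⟩

lemma IsIsomorphic.ncard_vertexSet {G : Graph α β} {H : Graph γ δ} (h : G.IsIsomorphic H) :
    G.vertexSet.ncard = H.vertexSet.ncard := by
  obtain ⟨φ, -, -⟩ := h
  exact Nat.card_congr φ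

lemma IsIsomorphic.ncard_edgeSet {G : Graph α β} {H : Graph γ δ} (h : G.IsIsomorphic H) :
    G.edgeSet.ncard = H.edgeSet.ncard := by
  obtain ⟨-, ψ, -⟩ := h
  exact Nat.card_congr ψ

lemma IsIsomorphic.exists_deleteEdges {G : Graph α β} {H : Graph γ δ} (h : G.IsIsomorphic H)
    (F : Set β) : ∃ F' ⊆ H.edgeSet, (G.deleteEdges F).IsIsomorphic (H.deleteEdges F') := by
  obtain ⟨φ, ψ, h⟩ := h
  refine ⟨{f | ∃ hf : f ∈ H.edgeSet, (ψ.symm ⟨f, hf⟩ : β) ∈ F}, fun f hf => hf.1, φ,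
    ⟨fun e => ⟨ψ ⟨e.1, e.2.1⟩, (ψ ⟨e.1, e.2.1⟩).2, fun hf => ?_⟩,
      fun f => ⟨ψ.symm ⟨f.1, f.2.1⟩, (ψ.symm ⟨f.1, f.2.1⟩).2, fun hf => ?_⟩, ?_, ?_⟩, ?_⟩
  · obtain ⟨hf, hF⟩ := hf
    exact e.2.2 (by simpa using hF)
  · exact f.2.2 ⟨f.2.1, hf⟩
  · intro e
    simp
  · intro f
    simp
  · intro e x y
    have he := e.2
    have h1 := h ⟨e.1, e.2.1⟩ x y
    simp only [deleteEdges_isLink, Equiv.coe_fn_mk]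
    refine ⟨fun hl => ⟨h1.1 hl.1, ?_⟩, fun hl => ⟨h1.2 hl.1, e.2.2⟩⟩
    rintro ⟨hf, hF⟩
    exact e.2.2 (by simpa using hF)

lemma reflTransGen_deleteEdges (G : Graph α β) {F : Set β} (hF : F.Finite)
    (hFG : F ⊆ G.edgeSet) :
    Relation.ReflTransGen IsElementaryMinor G (G.deleteEdges F) := by
  induction F, hF using Set.Finite.induction_on with
  | empty => rw [deleteEdges_empty]
  | @insert a s ha _ ih =>
    have h := ih fun x hx => hFG (Set.mem_insert_of_mem _ hx)
    have h2 : G.deleteEdges (insert a s) = (G.deleteEdges s).deleteEdges {a} := by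
      rw [deleteEdges_deleteEdges, Set.union_singleton]
    rw [h2]
    exact h.tail (.deleteEdge a ⟨hFG (Set.mem_insert _ _), ha⟩)

/-! ### Minors -/

lemma IsElementaryMinor.edgeSet_subset {G K : Graph α β} (h : G.IsElementaryMinor K) :
    K.edgeSet ⊆ G.edgeSet := by
  cases h with
  | deleteVertex x hx hi => exact deleteVerts_le.edgeSet_mono
  | deleteEdge e he => exact deleteEdges_le.edgeSet_mono
  | contract e x y he hp => exact Set.sdiff_subset

lemma edgeSet_subset_of_reflTransGen {G K : Graph α β}
    (h : Relation.ReflTransGen IsElementaryMinor G K) : K.edgeSet ⊆ G.edgeSet := by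
  induction h with
  | refl => exact subset_rfl
  | tail _ h ih => exact h.edgeSet_subset.trans ih

/-- If `G` arises from `G'` by deleting edges, then `G` is a minor of everything that `G'` is a
minor of. This is the only instance of transitivity of the minor relation that is needed. -/
lemma IsMinorOf.of_deleteEdges {G : Graph α β} {G' : Graph γ δ} {H : Graph ε ζ} {F : Set δ}
    (hG : G.IsIsomorphic (G'.deleteEdges F)) (hH : H.edgeSet.Finite) (h : G'.IsMinorOf H) :
    G.IsMinorOf H := by
  obtain ⟨K, hK, hiso⟩ := h
  obtain ⟨F', hF', hiso'⟩ := hiso.exists_deleteEdges F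
  have hfin := hH.subset (edgeSet_subset_of_reflTransGen hK)
  exact ⟨_, hK.trans (K.reflTransGen_deleteEdges (hfin.subset hF') hF'), hG.trans hiso'⟩

lemma IsMinorOf.refl (G : Graph α β) : G.IsMinorOf G := ⟨G, .refl, .refl G⟩

/-! ### The spectator floor -/

lemma spectatorFloor_le {G : Graph α β} {γ : Type u} {δ : Type v} {H : Graph γ δ}
    (hH : H.IsFiniteMultigraph) (h : G.IsMinorOf H) : G.spectatorFloor ≤ H.spectatorNumber :=
  Nat.sInf_le ⟨γ, δ, H, hH, h, rfl⟩

lemma exists_spectatorNumber_eq_spectatorFloor {G : Graph α β} (hG : G.IsFiniteMultigraph) :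
    ∃ (γ : Type u) (δ : Type v) (H : Graph γ δ),
      H.IsFiniteMultigraph ∧ G.IsMinorOf H ∧ G.spectatorFloor = H.spectatorNumber :=
  Nat.sInf_mem (s := {s | ∃ (γ : Type u) (δ : Type v) (H : Graph γ δ),
    H.IsFiniteMultigraph ∧ G.IsMinorOf H ∧ s = H.spectatorNumber})
    ⟨_, α, β, G, hG, .refl G, rfl⟩

lemma spectatorFloor_le_of_deleteEdges {G : Graph α β} {γ : Type u} {δ : Type v} {G' : Graph γ δ}
    {F : Set δ} (hG : G.IsIsomorphic (G'.deleteEdges F)) (hG' : G'.IsFiniteMultigraph) :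
    G.spectatorFloor ≤ G'.spectatorFloor := by
  obtain ⟨γ, δ, H, hH, hm, heq⟩ := exists_spectatorNumber_eq_spectatorFloor hG'
  rw [heq]
  exact spectatorFloor_le hH (hm.of_deleteEdges hG hH.finite_edgeSet)

/-! ### Layouts -/

/-- A layout of `G` of length `ℓ`: the vertices are placed on the points `0, 1, …, 2 * ℓ` of a line
so that adjacent vertices have distance at most `2`. Each even point carries exactly one vertex,
and no two edges joining vertices on even points are parallel. The vertices on even points
play the role of a path with `ℓ` edges, those on odd points that of spectators. -/
structure IsLayout (G : Graph α β) (ℓ : ℕ) (f : α → ℕ) : Prop where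
  le : ∀ x ∈ G.vertexSet, f x ≤ 2 * ℓ
  surj : ∀ i ≤ ℓ, ∃ x ∈ G.vertexSet, f x = 2 * i
  inj : ∀ x ∈ G.vertexSet, ∀ y ∈ G.vertexSet, f x = f y → f x % 2 = 0 → x = y
  link : ∀ e x y, G.IsLink e x y → f x ≤ f y + 2
  simple : ∀ e e' x y, G.IsLink e x y → G.IsLink e' x y → f x % 2 = 0 → f y % 2 = 0 → e = e'

/-- The position, in a layout shortened from length `ℓ` to `ℓ - 1`, of a vertex at `t` after the
vertex at `2 * j` has been turned into a spectator. For `0 < j < ℓ` the points `2 * j - 1`, `2 * j`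
and `2 * j + 1` are identified. At an end of the line, the end point and the odd point next to
it are moved to the outermost odd point of the shorter line. -/
def demote (ℓ j t : ℕ) : ℕ :=
  if j = 0 then (if t ≤ 1 then 1 else t - 2)
  else if j = ℓ then (if t ≤ 2 * ℓ - 2 then t else 2 * ℓ - 3)
  else if t < 2 * j then t else if t = 2 * j then 2 * j - 1 else t - 2

/-- The position of a vertex at `t` after the vertices at `2 * i` and `2 * i + 2` have been
identified. The spectators between them take an odd point next to the merged vertex. -/
def squeeze (i t : ℕ) : ℕ :=
  if t ≤ 2 * i then t else if t = 2 * i + 1 then (if i = 0 then 1 else 2 * i - 1) else t - 2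

lemma IsLayout.demote {G : Graph α β} {ℓ : ℕ} {f : α → ℕ} (h : G.IsLayout (ℓ + 2) f) {j : ℕ}
    (hj : j ≤ ℓ + 2) : G.IsLayout (ℓ + 1) (fun x => demote (ℓ + 2) j (f x)) where
  le x hx := by
    have := h.le x hx
    unfold Graph.demote
    split_ifs <;> omega
  surj i hi := by
    obtain ⟨x, hx, hfx⟩ := h.surj (if i < j then i else i + 1) (by split_ifs <;> omega)
    refine ⟨x, hx, ?_⟩
    unfold Graph.demote
    split_ifs at hfx ⊢ <;> omega
  inj x hx y hy hxy he := by
    have := h.le x hx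
    have := h.le y hy
    refine h.inj x hx y hy ?_ ?_ <;> unfold Graph.demote at hxy he <;>
      split_ifs at hxy he <;> omega
  link e x y hl := by
    have := h.link e x y hl
    have := h.link e y x hl.symm
    have := h.le x hl.left_mem
    have := h.le y hl.right_mem
    unfold Graph.demote
    split_ifs <;> omega
  simple e e' x y hl hl' hx hy := by
    have := h.le x hl.left_mem
    have := h.le y hl.right_mem
    refine h.simple e e' x y hl hl' ?_ ?_
    · unfold Graph.demote at hx
      split_ifs at hx <;> omega
    · unfold Graph.demote at hy
      split_ifs at hy <;> omega

lemma IsLayout.deleteEdges {G : Graph α β} {ℓ : ℕ} {f : α → ℕ} (h : G.IsLayout ℓ f) (F : Set β) :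
    (G.deleteEdges F).IsLayout ℓ f where
  le := h.le
  surj := h.surj
  inj := h.inj
  link e x y hl := h.link e x y hl.1
  simple e e' x y hl hl' := h.simple e e' x y hl.1 hl'.1

/-- A spectator can be deleted without changing the length of the layout. -/
lemma IsLayout.deleteVerts {G : Graph α β} {ℓ : ℕ} {f : α → ℕ} (h : G.IsLayout ℓ f) {z : α}
    (hz : f z % 2 = 1) : (G.deleteVerts {z}).IsLayout ℓ f where
  le x hx := h.le x (by simpa using (vertexSet_deleteVerts _ _ ▸ hx).1)
  surj i hi := by
    obtain ⟨x, hx, hfx⟩ := h.surj i hi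
    refine ⟨x, ?_, hfx⟩
    rw [vertexSet_deleteVerts]
    refine ⟨hx, ?_⟩
    rintro rfl
    omega
  inj x hx y hy := h.inj x (vertexSet_deleteVerts _ _ ▸ hx).1 y (vertexSet_deleteVerts _ _ ▸ hy).1
  link e x y hl := h.link e x y ((deleteVerts_isLink _ _).1 hl).1
  simple e e' x y hl hl' :=
    h.simple e e' x y ((deleteVerts_isLink _ _).1 hl).1 ((deleteVerts_isLink _ _).1 hl').1

open scoped Classical in
lemma vertexSet_contractEdge {G : Graph α β} {e : β} {x y : α} (h : G.IsLink e x y)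
    (hxy : x ≠ y) : (G.contractEdge e x y).vertexSet = G.vertexSet \ {y} := by
  ext z
  change z ∈ (fun z => if z = y then x else z) '' G.vertexSet ↔ _
  have := h.left_mem
  constructor
  · rintro ⟨w, hw, rfl⟩
    dsimp only
    split_ifs with hwy
    · exact ⟨this, hxy⟩
    · exact ⟨hw, hwy⟩
  · rintro ⟨hz, hzy⟩
    exact ⟨z, hz, if_neg hzy⟩

open scoped Classical in
lemma contractEdge_isLink {G : Graph α β} {e g : β} {x y a b : α} :
    (G.contractEdge e x y).IsLink g a b ↔ ∃ u w, G.IsLink g u w ∧ g ≠ e ∧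
      (if u = y then x else u) = a ∧ (if w = y then x else w) = b := by
  change (∃ u w, (G.IsLink g u w ∧ g ∉ ({e} : Set β)) ∧ _ ∧ _) ↔ _
  simp only [Set.mem_singleton_iff, and_assoc, ne_eq]

/-- Two spectators at the same point can be identified. -/
lemma IsLayout.contract_spectators {G : Graph α β} {ℓ : ℕ} {f : α → ℕ} (h : G.IsLayout ℓ f)
    {e : β} {x y : α} (he : G.IsLink e x y) (hxy : x ≠ y) (hf : f x = f y) (hodd : f x % 2 = 1) :
    (G.contractEdge e x y).IsLayout ℓ f := by
  classical
  have hr : ∀ z, f (if z = y then x else z) = f z := by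
    intro z
    split_ifs with hz
    · rw [hf, hz]
    · rfl
  have hr' : ∀ z, f z % 2 = 0 → (if z = y then x else z) = z := by
    intro z hz
    refine if_neg ?_
    rintro rfl
    omega
  have hV := vertexSet_contractEdge he hxy
  refine ⟨?_, ?_, ?_, ?_, ?_⟩
  · intro z hz
    rw [hV] at hz
    exact h.le z hz.1
  · intro i hi
    obtain ⟨z, hz, hfz⟩ := h.surj i hi
    refine ⟨z, ?_, hfz⟩
    rw [hV]
    refine ⟨hz, ?_⟩
    rintro rfl
    omega
  · intro a ha b hb
    rw [hV] at ha hb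
    exact h.inj a ha.1 b hb.1
  · intro g a b hab
    obtain ⟨u, w, hl, -, rfl, rfl⟩ := contractEdge_isLink.1 hab
    rw [hr, hr]
    exact h.link g u w hl
  · intro g g' a b hab hab' ha hb
    obtain ⟨u, w, hl, -, rfl, rfl⟩ := contractEdge_isLink.1 hab
    obtain ⟨u', w', hl', -, hu, hw⟩ := contractEdge_isLink.1 hab'
    have hu' := congrArg f hu
    have hw' := congrArg f hw
    simp only [hr] at ha hb hu' hw'
    rw [hr' _ ha, hr' u' (by omega)] at hu
    rw [hr' _ hb, hr' w' (by omega)] at hw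
    subst hu hw
    exact h.simple g g' _ _ hl hl' ha hb

/-- Contracting an edge that joins two consecutive vertices on even points shortens the layout. -/
lemma IsLayout.contract_path {G : Graph α β} {ℓ : ℕ} {f : α → ℕ} (h : G.IsLayout (ℓ + 2) f)
    {e : β} {x y : α} (he : G.IsLink e x y) (hp : ∀ g, G.IsLink g x y → g = e) {i : ℕ}
    (hxy : f x = 2 * i ∧ f y = 2 * i + 2 ∨ f x = 2 * i + 2 ∧ f y = 2 * i)
    (hloop : ∀ g z, ¬ G.IsLink g z z) :
    (G.contractEdge e x y).IsLayout (ℓ + 1) (fun z => squeeze i (f z)) := by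
  classical
  have hne : x ≠ y := by
    rintro rfl
    exact hloop _ _ he
  have hx := he.left_mem
  have hy := he.right_mem
  have hlx := h.le x hx
  have hly := h.le y hy
  have hr : ∀ z, squeeze i (f (if z = y then x else z)) = squeeze i (f z) := by
    intro z
    split_ifs with hz
    · subst hz
      unfold squeeze
      split_ifs <;> omega
    · rfl
  have hV := vertexSet_contractEdge he hne
  have heven : ∀ t, squeeze i t % 2 = 0 → t % 2 = 0 := by
    intro t ht
    unfold squeeze at ht
    split_ifs at ht <;> omega
  -- Vertices on even points that are identified are equal or are the two ends of `e`.
  have hinj : ∀ u ∈ G.vertexSet, ∀ w ∈ G.vertexSet, squeeze i (f u) = squeeze i (f w) →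
      squeeze i (f u) % 2 = 0 → u = w ∨ u = x ∧ w = y ∨ u = y ∧ w = x := by
    intro u hu w hw huw hev
    have h1 := heven _ hev
    have h2 := heven _ (huw ▸ hev)
    have h3 : f u = f w ∨ f u = f x ∧ f w = f y ∨ f u = f y ∧ f w = f x := by
      unfold squeeze at huw
      split_ifs at huw <;> omega
    rcases h3 with h3 | h3 | h3
    · exact .inl (h.inj u hu w hw h3 h1)
    · exact .inr (.inl ⟨h.inj u hu x hx h3.1 h1, h.inj w hw y hy h3.2 h2⟩)
    · exact .inr (.inr ⟨h.inj u hu y hy h3.1 h1, h.inj w hw x hx h3.2 h2⟩)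
  -- A vertex on an even point adjacent to both ends of `e` would lie between them.
  have hboth : ∀ g g' z, G.IsLink g x z → G.IsLink g' y z → f z % 2 = 0 → False := by
    intro g g' z hg hg' hz
    have h1 := h.link _ _ _ hg
    have h2 := h.link _ _ _ hg.symm
    have h3 := h.link _ _ _ hg'
    have h4 := h.link _ _ _ hg'.symm
    rcases (by omega : f z = f x ∨ f z = f y) with hz' | hz'
    · exact hloop g x (by rwa [h.inj z hg.right_mem x hx hz' hz] at hg)
    · exact hloop g' y (by rwa [h.inj z hg.right_mem y hy hz' hz] at hg')
  refine ⟨?_, ?_, ?_, ?_, ?_⟩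
  · intro z hz
    rw [hV] at hz
    have := h.le z hz.1
    unfold squeeze
    split_ifs <;> omega
  · intro j hj
    have : ∃ z ∈ G.vertexSet, squeeze i (f z) = 2 * j := by
      obtain ⟨z, hz, hfz⟩ := h.surj (if j ≤ i then j else j + 1) (by split_ifs <;> omega)
      refine ⟨z, hz, ?_⟩
      unfold squeeze
      split_ifs at hfz ⊢ <;> omega
    obtain ⟨z, hz, hfz⟩ := this
    refine ⟨if z = y then x else z, ?_, (hr z).trans hfz⟩
    rw [hV]
    split_ifs with hzy
    · exact ⟨hx, hne⟩
    · exact ⟨hz, hzy⟩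
  · intro a ha b hb hab hev
    rw [hV] at ha hb
    rcases hinj a ha.1 b hb.1 hab hev with h1 | h1 | h1
    · exact h1
    · exact absurd h1.2 hb.2
    · exact absurd h1.1 ha.2
  · intro g a b hab
    obtain ⟨u, w, hl, -, rfl, rfl⟩ := contractEdge_isLink.1 hab
    simp only [hr]
    have h1 := h.link g u w hl
    have h2 := h.link g w u hl.symm
    unfold squeeze
    split_ifs <;> omega
  · intro g g' a b hab hab' ha hb
    obtain ⟨u, w, hl, hge, rfl, rfl⟩ := contractEdge_isLink.1 hab
    obtain ⟨u', w', hl', hge', hu, hw⟩ := contractEdge_isLink.1 hab'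
    have hu' := congrArg (fun z => squeeze i (f z)) hu
    have hw' := congrArg (fun z => squeeze i (f z)) hw
    simp only [hr] at ha hb hu' hw'
    have h1 := heven _ ha
    have h2 := heven _ hb
    have hfin : ∀ k ∈ ({g, g'} : Set β), ∀ s t, G.IsLink k s t →
        ¬ (s = x ∧ t = y) ∧ ¬ (s = y ∧ t = x) := by
      rintro k hk s t hst
      have hke : k ≠ e := by
        rcases hk with rfl | rfl <;> assumption
      refine ⟨?_, ?_⟩
      · rintro ⟨rfl, rfl⟩
        exact hke (hp _ hst)
      · rintro ⟨rfl, rfl⟩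
        exact hke (hp _ hst.symm)
    have h3 := hfin g (by simp) _ _ hl
    have h4 := hfin g' (by simp) _ _ hl'
    rcases hinj _ hl.left_mem _ hl'.left_mem hu'.symm ha with rfl | ⟨rfl, rfl⟩ | ⟨rfl, rfl⟩ <;>
    rcases hinj _ hl.right_mem _ hl'.right_mem hw'.symm hb with rfl | ⟨rfl, rfl⟩ | ⟨rfl, rfl⟩
    · exact h.simple g g' _ _ hl hl' h1 h2
    · exact (hboth _ _ _ hl.symm hl'.symm h1).elim
    · exact (hboth _ _ _ hl'.symm hl.symm h1).elim
    · exact (hboth _ _ _ hl hl' h2).elim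
    · exact (hloop _ _ hl).elim
    · simp at h3
    · exact (hboth _ _ _ hl' hl h2).elim
    · simp at h3
    · exact (hloop _ _ hl).elim

/-- `G` is finite and loopless, and has at most `k + 1` vertices or a layout of positive length with
exactly `k` spectators. The first alternative covers what would be a layout of length `0`, where
nothing is required of the edges. -/
structure HasSpectators (G : Graph α β) (k : ℕ) : Prop where
  finite : G.vertexSet.Finite
  loopless : ∀ e x, ¬ G.IsLink e x x
  layout : G.vertexSet.ncard ≤ k + 1 ∨
    ∃ ℓ f, G.IsLayout (ℓ + 1) f ∧ G.vertexSet.ncard = ℓ + 2 + k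

lemma HasSpectators.deleteVerts {G : Graph α β} {k : ℕ} (h : G.HasSpectators k) {x : α}
    (hx : x ∈ G.vertexSet) : (G.deleteVerts {x}).HasSpectators k := by
  have hV : (G.deleteVerts {x}).vertexSet = G.vertexSet \ {x} := vertexSet_deleteVerts _ _
  have hc := Set.ncard_sdiff_singleton_add_one hx h.finite
  refine ⟨hV ▸ h.finite.subset Set.sdiff_subset, fun e z hl =>
    h.loopless e z ((deleteVerts_isLink _ _).1 hl).1, ?_⟩
  rw [hV]
  rcases h.layout with h1 | ⟨_ | ℓ, f, hf, h1⟩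
  · left; omega
  · left; omega
  right
  -- A vertex on an even point is made a spectator first.
  obtain ⟨j, hj, hodd⟩ : ∃ j ≤ ℓ + 2, demote (ℓ + 2) j (f x) % 2 = 1 := by
    have := hf.le x hx
    by_cases hpar : f x % 2 = 0
    · refine ⟨f x / 2, by omega, ?_⟩
      unfold demote
      split_ifs <;> omega
    · refine ⟨ℓ + 2, le_rfl, ?_⟩
      unfold demote
      split_ifs <;> omega
  exact ⟨ℓ, _, (hf.demote hj).deleteVerts hodd, by omega⟩

lemma HasSpectators.contractEdge {G : Graph α β} {k : ℕ} (h : G.HasSpectators k) {e : β} {x y : α}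
    (he : G.IsLink e x y) (hp : ∀ g, G.IsLink g x y → g = e) :
    (G.contractEdge e x y).HasSpectators k := by
  classical
  have hne : x ≠ y := by
    rintro rfl
    exact h.loopless _ _ he
  have hV := vertexSet_contractEdge he hne
  have hc := Set.ncard_sdiff_singleton_add_one he.right_mem h.finite
  refine ⟨hV ▸ h.finite.subset Set.sdiff_subset, fun g z hab => ?_, ?_⟩
  · obtain ⟨u, w, hl, hge, rfl, hw⟩ := contractEdge_isLink.1 hab
    split_ifs at hw with h1 h2 h2
    · subst h1 h2
      exact h.loopless _ _ hl
    · subst h1 hw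
      exact hge (hp _ hl)
    · subst h2 hw
      exact hge (hp _ hl.symm)
    · subst hw
      exact h.loopless _ _ hl
  rw [hV]
  rcases h.layout with h1 | ⟨_ | ℓ, f, hf, h1⟩
  · left; omega
  · left; omega
  right
  have hlx := hf.le x he.left_mem
  have hly := hf.le y he.right_mem
  have hl1 := hf.link _ _ _ he
  have hl2 := hf.link _ _ _ he.symm
  by_cases hev : f x % 2 = 0 ∧ f y % 2 = 0
  · have hfne : f x ≠ f y := fun hxy => hne (hf.inj x he.left_mem y he.right_mem hxy hev.1)
    exact ⟨ℓ, _, hf.contract_path (i := min (f x) (f y) / 2) he hp (by omega) h.loopless, by omega⟩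
  -- Some vertex on an even point can be made a spectator so that the ends of `e` come together.
  obtain ⟨j, hj, hodd, heq⟩ : ∃ j ≤ ℓ + 2, demote (ℓ + 2) j (f x) % 2 = 1 ∧
      demote (ℓ + 2) j (f x) = demote (ℓ + 2) j (f y) := by
    by_cases h2 : f x % 2 = 0
    · refine ⟨f x / 2, by omega, ?_⟩
      unfold demote
      split_ifs <;> omega
    by_cases h3 : f y % 2 = 0
    · refine ⟨f y / 2, by omega, ?_⟩
      unfold demote
      split_ifs <;> omega
    · refine ⟨(min (f x) (f y) + 1) / 2, by omega, ?_⟩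
      unfold demote
      split_ifs <;> omega
  exact ⟨ℓ, _, (hf.demote hj).contract_spectators he hne heq hodd, by omega⟩

lemma HasSpectators.of_isElementaryMinor {G K : Graph α β} {k : ℕ} (h : G.HasSpectators k)
    (hK : G.IsElementaryMinor K) : K.HasSpectators k := by
  cases hK with
  | deleteVertex x hx hi => exact h.deleteVerts hx
  | deleteEdge e he =>
    refine ⟨h.finite, fun g z hl => h.loopless g z hl.1, ?_⟩
    rcases h.layout with h1 | ⟨ℓ, f, hf, h1⟩
    · exact .inl h1
    · exact .inr ⟨ℓ, f, hf.deleteEdges _, h1⟩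
  | contract e x y he hp => exact h.contractEdge he hp

lemma HasSpectators.of_reflTransGen {G K : Graph α β} {k : ℕ} (h : G.HasSpectators k)
    (hK : Relation.ReflTransGen IsElementaryMinor G K) : K.HasSpectators k := by
  induction hK with
  | refl => exact h
  | tail _ hm ih => exact ih.of_isElementaryMinor hm

lemma IsIsomorphic.isLayout {G : Graph α β} {H : Graph γ δ} (h : G.IsIsomorphic H) {ℓ : ℕ}
    {f : γ → ℕ} (hf : H.IsLayout ℓ f) : ∃ f', G.IsLayout ℓ f' := by
  classical
  obtain ⟨φ, ψ, hl⟩ := h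
  let f' : α → ℕ := fun x => if hx : x ∈ G.vertexSet then f (φ ⟨x, hx⟩) else 0
  have hf' : ∀ x (hx : x ∈ G.vertexSet), f' x = f (φ ⟨x, hx⟩) := fun x hx => dif_pos hx
  have hl' : ∀ e x y (h : G.IsLink e x y), H.IsLink (ψ ⟨e, h.edge_mem⟩) (φ ⟨x, h.left_mem⟩)
      (φ ⟨y, h.right_mem⟩) := fun e x y h =>
    (hl ⟨e, h.edge_mem⟩ ⟨x, h.left_mem⟩ ⟨y, h.right_mem⟩).1 h
  refine ⟨f', fun x hx => ?_, fun i hi => ?_, fun x hx y hy hxy hev => ?_, fun e x y h => ?_,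
    fun e e' x y h h' hx hy => ?_⟩
  · rw [hf' x hx]
    exact hf.le _ (φ ⟨x, hx⟩).2
  · obtain ⟨z, hz, hfz⟩ := hf.surj i hi
    refine ⟨φ.symm ⟨z, hz⟩, (φ.symm ⟨z, hz⟩).2, ?_⟩
    rw [hf' _ (φ.symm ⟨z, hz⟩).2]
    simpa using hfz
  · rw [hf' x hx] at hev hxy
    rw [hf' y hy] at hxy
    have := hf.inj _ (φ ⟨x, hx⟩).2 _ (φ ⟨y, hy⟩).2 hxy hev
    simpa using φ.injective (Subtype.ext this)
  · rw [hf' x h.left_mem, hf' y h.right_mem]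
    exact hf.link _ _ _ (hl' e x y h)
  · rw [hf' x h.left_mem] at hx
    rw [hf' y h.right_mem] at hy
    have := hf.simple _ _ _ _ (hl' e x y h) (hl' e' x y h') hx hy
    simpa using ψ.injective (Subtype.ext this)

/-! ### Walks in the underlying simple graph -/

/-- The simple graph with the same adjacencies. Its walks replace the paths of `G` where only the
vertices matter. -/
def toSimple (G : Graph α β) : SimpleGraph α where
  Adj x y := x ≠ y ∧ G.Adj x y
  symm := ⟨fun _ _ h => ⟨h.1.symm, h.2.symm⟩⟩
  loopless := ⟨fun _ h => h.1 rfl⟩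

lemma Adj.toSimple_adj {G : Graph α β} {x y : α} (h : G.Adj x y) (hxy : x ≠ y) :
    G.toSimple.Adj x y :=
  ⟨hxy, h⟩

lemma mem_vertexSet_of_walk {G : Graph α β} {x y : α} (W : G.toSimple.Walk x y)
    (hx : x ∈ G.vertexSet) : y ∈ G.vertexSet := by
  induction W with
  | nil => exact hx
  | cons h _ ih => exact ih h.2.right_mem

lemma exists_isPath_of_walk {G : Graph α β} {x y : α} (W : G.toSimple.Walk x y)
    (hx : x ∈ G.vertexSet) (hW : W.IsPath) :
    ∃ e, G.IsPath W.length (fun i => W.getVert i) e := by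
  have hadj : ∀ i : Fin W.length, ∃ e, G.IsLink e (W.getVert i) (W.getVert (i + 1)) :=
    fun i => (W.adj_getVert_succ i.2).2
  choose e he using hadj
  refine ⟨e, ⟨fun i => mem_vertexSet_of_walk (W.take i) hx, he⟩, fun i j hij => ?_⟩
  exact Fin.ext (hW.getVert_injOn (Nat.lt_succ_iff.1 i.2) (Nat.lt_succ_iff.1 j.2) hij)

lemma IsPath.exists_walk {G : Graph α β} {k : ℕ} {p : Fin (k + 1) → α} {e : Fin k → β}
    (h : G.IsPath k p e) : ∀ (d : ℕ) (i j : Fin (k + 1)), (j : ℕ) = i + d →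
      ∃ W : G.toSimple.Walk (p i) (p j), W.length = d := by
  intro d
  induction d with
  | zero =>
    intro i j hij
    obtain rfl : j = i := Fin.ext (by simpa using hij)
    exact ⟨.nil, rfl⟩
  | succ d ih =>
    intro i j hij
    have hik : (i : ℕ) < k := by omega
    obtain ⟨W, hW⟩ := ih (⟨i, hik⟩ : Fin k).succ j (by simp; omega)
    have hl := h.isLink ⟨i, hik⟩
    have hi : (⟨i, hik⟩ : Fin k).castSucc = i := rfl
    rw [hi] at hl
    have hadj : G.toSimple.Adj (p i) (p (⟨i, hik⟩ : Fin k).succ) := by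
      refine hl.adj.toSimple_adj fun heq => ?_
      have := congrArg Fin.val (h.injective heq)
      simp at this
    exact ⟨.cons hadj W, congrArg (· + 1) hW⟩

/-- A walk between the ends of a shortest path is at least as long as the path; if the path is a
unique shortest path and the lengths agree, then the walk visits vertices of the path only. -/
lemma IsUniqueShortestPath.le_length_walk {G : Graph α β} {k : ℕ} {p : Fin (k + 1) → α}
    {e : Fin k → β} (h : G.IsUniqueShortestPath k p e)
    (W : G.toSimple.Walk (p 0) (p (Fin.last k))) :
    k ≤ W.length ∧ (W.length ≤ k → ∀ x ∈ W.support, x ∈ Set.range p) := by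
  classical
  have key : ∀ W' : G.toSimple.Walk (p 0) (p (Fin.last k)), W'.IsPath →
      k ≤ W'.length ∧ (W'.length = k → ∀ x ∈ W'.support, x ∈ Set.range p) := by
    intro W' hW'
    obtain ⟨f, hf⟩ := exists_isPath_of_walk W' (h.vertex_mem 0) hW'
    have hle := h.le_length _ _ f hf (by simp) (by simp)
    refine ⟨hle, fun hk x hx => ?_⟩
    obtain ⟨i, rfl, hi⟩ := SimpleGraph.Walk.mem_support_iff_exists_getVert.1 hx
    generalize hl : W'.length = l at f hf hk hi
    subst hk
    have hq := (h.unique _ f hf (by simp) (by simp [← hl])).1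
    exact ⟨⟨i, by omega⟩, (congrFun hq ⟨i, by omega⟩).symm⟩
  have hb := key W.bypass W.bypass_isPath
  have hle := W.length_bypass_le_length
  refine ⟨hb.1.trans hle, fun hk => ?_⟩
  have heq := W.bypass_eq_self_of_length_le_length_bypass (hk.trans hb.1)
  rw [heq] at hb
  exact hb.2 (le_antisymm hk hb.1)

lemma IsUniqueShortestPath.eq_of_isLink {G : Graph α β} {k : ℕ} {p : Fin (k + 1) → α}
    {e : Fin k → β} (h : G.IsUniqueShortestPath k p e) (i : Fin k) {g : β}
    (hg : G.IsLink g (p i.castSucc) (p i.succ)) : g = e i := by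
  classical
  have hpath : G.IsPath k p (Function.update e i g) := by
    refine ⟨⟨h.vertex_mem, fun j => ?_⟩, h.injective⟩
    by_cases hj : j = i
    · subst hj
      simpa using hg
    · simpa [hj] using h.isLink j
  have := congrFun (h.unique p _ hpath rfl rfl).2 i
  simpa using this

/-! ### The layout given by a unique shortest path -/

/-- The distance from `x` to `y`, but at most `L`; it is `L` if there is no walk. -/
noncomputable def clampedDist (G : Graph α β) (L : ℕ) (x y : α) : ℕ :=
  sInf {l | l = L ∨ ∃ W : G.toSimple.Walk x y, W.length = l}

lemma clampedDist_le (G : Graph α β) (L : ℕ) (x y : α) : G.clampedDist L x y ≤ L :=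
  Nat.sInf_le (.inl rfl)

lemma clampedDist_le_length {G : Graph α β} (L : ℕ) {x y : α} (W : G.toSimple.Walk x y) :
    G.clampedDist L x y ≤ W.length :=
  Nat.sInf_le (.inr ⟨W, rfl⟩)

lemma clampedDist_eq_or (G : Graph α β) (L : ℕ) (x y : α) : G.clampedDist L x y = L ∨
    ∃ W : G.toSimple.Walk x y, W.length = G.clampedDist L x y :=
  Nat.sInf_mem (s := {l | l = L ∨ ∃ W : G.toSimple.Walk x y, W.length = l}) ⟨L, .inl rfl⟩

lemma clampedDist_le_succ {G : Graph α β} (L : ℕ) {x y z : α} (h : G.toSimple.Adj y z) :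
    G.clampedDist L x z ≤ G.clampedDist L x y + 1 := by
  rcases G.clampedDist_eq_or L x y with h1 | ⟨W, hW⟩
  · have := G.clampedDist_le L x z
    omega
  · rw [← hW, ← SimpleGraph.Walk.length_concat W h]
    exact clampedDist_le_length L _

/-- A unique shortest path with `L ≥ 1` edges yields a layout of length `L`: its vertices take the
even points in order, and a vertex outside it takes the odd point determined by its distance from
the start of the path. -/
lemma IsUniqueShortestPath.exists_isLayout {G : Graph α β} {L : ℕ} (hL : 1 ≤ L)
    {p : Fin (L + 1) → α} {e : Fin L → β} (h : G.IsUniqueShortestPath L p e)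
    (hloop : ∀ g x, ¬ G.IsLink g x x) : ∃ f, G.IsLayout L f := by
  classical
  let f : α → ℕ := fun x => if hx : ∃ i, p i = x then 2 * (hx.choose : ℕ)
    else 2 * G.clampedDist L (p 0) x - 1
  have hfp : ∀ i, f (p i) = 2 * (i : ℕ) := by
    intro i
    have hx : ∃ j, p j = p i := ⟨i, rfl⟩
    have h1 : f (p i) = 2 * (hx.choose : ℕ) := dif_pos hx
    rw [h1, h.injective hx.choose_spec]
  have hfw : ∀ x, (∀ i, p i ≠ x) → f x = 2 * G.clampedDist L (p 0) x - 1 := by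
    intro x hx
    exact dif_neg (by simpa using hx)
  have hpos : ∀ x, (∀ i, p i ≠ x) → 1 ≤ G.clampedDist L (p 0) x := by
    intro x hx
    rcases G.clampedDist_eq_or L (p 0) x with h1 | ⟨W, hW⟩
    · omega
    · rw [← hW]
      by_contra! hlt
      exact hx 0 (SimpleGraph.Walk.eq_of_length_eq_zero (p := W) (by omega))
  have hdle := fun x => G.clampedDist_le L (p 0) x
  have hadj : ∀ {g x y}, G.IsLink g x y → G.toSimple.Adj x y := fun {g x y} hg =>
    hg.adj.toSimple_adj fun hxy => hloop g x (by rwa [← hxy] at hg)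
  -- A link between vertices of the path does not skip a vertex of the path.
  have hpp : ∀ g (i j : Fin (L + 1)), G.IsLink g (p i) (p j) → (j : ℕ) ≤ i + 1 := by
    intro g i j hg
    by_contra! hlt
    obtain ⟨W₁, hW₁⟩ := IsPath.exists_walk h.toIsPath i 0 i (by simp)
    obtain ⟨W₂, hW₂⟩ := IsPath.exists_walk h.toIsPath (L - j) j (Fin.last L) (by
      simp only [Fin.val_last]; omega)
    have := (h.le_length_walk (W₁.append (.cons (hadj hg) W₂))).1
    simp only [SimpleGraph.Walk.length_append, SimpleGraph.Walk.length_cons] at this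
    omega
  -- A vertex outside the path is not closer to the start than its neighbours on the path.
  have hpw : ∀ g (i : Fin (L + 1)) w, (∀ i, p i ≠ w) → G.IsLink g (p i) w →
      (i : ℕ) ≤ G.clampedDist L (p 0) w ∧ G.clampedDist L (p 0) w ≤ i + 1 := by
    intro g i w hw hg
    constructor
    · rcases G.clampedDist_eq_or L (p 0) w with h1 | ⟨W, hW⟩
      · omega
      · by_contra! hlt
        obtain ⟨W₂, hW₂⟩ := IsPath.exists_walk h.toIsPath (L - i) i (Fin.last L) (by
          simp only [Fin.val_last]; omega)
        have := (h.le_length_walk (W.append (.cons (hadj hg).symm W₂))).2 (by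
          simp only [SimpleGraph.Walk.length_append, SimpleGraph.Walk.length_cons]
          omega) w (by simp)
        obtain ⟨j, hj⟩ := this
        exact hw j hj
    · obtain ⟨W₁, hW₁⟩ := IsPath.exists_walk h.toIsPath i 0 i (by simp)
      have := clampedDist_le_length L (W₁.concat (hadj hg))
      rwa [SimpleGraph.Walk.length_concat, hW₁] at this
  have hcases : ∀ x, (∃ i, p i = x) ∨ ∀ i, p i ≠ x := fun x => by
    by_cases hx : ∃ i, p i = x
    · exact .inl hx
    · exact .inr (by simpa using hx)
  have hodd : ∀ x, f x % 2 = 0 → ∃ i, p i = x := by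
    intro x hx
    rcases hcases x with h1 | h1
    · exact h1
    · have := hfw x h1
      have := hpos x h1
      omega
  refine ⟨f, fun x hx => ?_, fun i hi => ?_, fun x hx y hy hxy hev => ?_, fun g x y hg => ?_,
    fun g g' x y hg hg' hx hy => ?_⟩
  · rcases hcases x with ⟨i, rfl⟩ | h1
    · rw [hfp]
      omega
    · rw [hfw x h1]
      have := hdle x
      omega
  · exact ⟨p ⟨i, by omega⟩, h.vertex_mem _, hfp _⟩
  · obtain ⟨i, rfl⟩ := hodd x hev
    obtain ⟨j, rfl⟩ := hodd y (hxy ▸ hev)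
    rw [hfp, hfp] at hxy
    rw [Fin.ext (by omega : (i : ℕ) = j)]
  · rcases hcases x with ⟨i, rfl⟩ | h1 <;> rcases hcases y with ⟨j, rfl⟩ | h2
    · have := hpp g j i hg.symm
      rw [hfp, hfp]
      omega
    · have := hpw g i y h2 hg
      have := hpos y h2
      rw [hfp, hfw y h2]
      omega
    · have := hpw g j x h1 hg.symm
      rw [hfp, hfw x h1]
      omega
    · have := clampedDist_le_succ (x := p 0) L (hadj hg.symm)
      have := hpos y h2
      rw [hfw x h1, hfw y h2]
      omega
  · obtain ⟨i, rfl⟩ := hodd x hx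
    obtain ⟨j, rfl⟩ := hodd y hy
    -- The two ends are consecutive on the path, in one of the two orders.
    have key : ∀ i j : Fin (L + 1), (j : ℕ) = i + 1 → G.IsLink g (p i) (p j) →
        G.IsLink g' (p i) (p j) → g = g' := by
      intro i j hij hg hg'
      have hi : (⟨i, by omega⟩ : Fin L).castSucc = i := rfl
      have hj : (⟨i, by omega⟩ : Fin L).succ = j := Fin.ext (by simp [hij])
      have h1 := h.eq_of_isLink (g := g) ⟨i, by omega⟩ (by rwa [hi, hj])
      have h2 := h.eq_of_isLink (g := g') ⟨i, by omega⟩ (by rwa [hi, hj])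
      exact h1.trans h2.symm
    have h1 := hpp g i j hg
    have h2 := hpp g j i hg.symm
    rcases Nat.lt_trichotomy i j with h3 | h3 | h3
    · exact key i j (by omega) hg hg'
    · rw [Fin.ext h3] at hg
      exact (hloop _ _ hg).elim
    · exact key j i (by omega) hg.symm hg'.symm

/-! ### The parade number -/

lemma IsPath.length_lt_ncard {G : Graph α β} (hG : G.vertexSet.Finite) {k : ℕ}
    {p : Fin (k + 1) → α} {e : Fin k → β} (h : G.IsPath k p e) : k + 1 ≤ G.vertexSet.ncard := by
  have h1 : (Set.range p).ncard = k + 1 := by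
    rw [← Set.image_univ, Set.ncard_image_of_injective _ h.injective, Set.ncard_univ]
    simp
  rw [← h1]
  exact Set.ncard_le_ncard (Set.range_subset_iff.2 h.vertex_mem) hG

lemma isUniqueShortestPath_singleton {G : Graph α β} {x : α} (hx : x ∈ G.vertexSet) :
    G.IsUniqueShortestPath 0 (fun _ => x) Fin.elim0 where
  vertex_mem _ := hx
  isLink i := i.elim0
  injective i j _ := Fin.ext (by omega)
  le_length _ _ _ _ _ _ := Nat.zero_le _
  unique q f _ h0 _ :=
    ⟨funext fun i => by rw [Fin.ext (by omega : (i : ℕ) = (0 : Fin 1)), h0], Subsingleton.elim _ _⟩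

/-- The parade number is attained, because the order of a path is at most the number of vertices. -/
lemma exists_paradeNumber_eq {G : Graph α β} (hG : G.IsFiniteMultigraph) :
    ∃ (k : ℕ) (p : Fin (k + 1) → α) (e : Fin k → β),
      G.IsUniqueShortestPath k p e ∧ G.paradeNumber = k + 1 := by
  obtain ⟨x, hx⟩ := hG.nonempty
  refine Nat.sSup_mem (s := {r | ∃ (k : ℕ) (p : Fin (k + 1) → α) (e : Fin k → β),
    G.IsUniqueShortestPath k p e ∧ r = k + 1})
    ⟨1, 0, _, _, isUniqueShortestPath_singleton hx, rfl⟩ ⟨G.vertexSet.ncard, ?_⟩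
  rintro r ⟨k, p, e, h, rfl⟩
  exact h.toIsPath.length_lt_ncard hG.finite_vertexSet

lemma IsParade.paradeNumber_eq {G : Graph α β} {k : ℕ} {p : Fin (k + 1) → α} {e : Fin k → β}
    (h : G.IsParade k p e) : G.paradeNumber = k + 1 := by
  refine le_antisymm (csSup_le ⟨k + 1, k, p, e, h.toIsUniqueShortestPath, rfl⟩ ?_)
    (le_csSup ⟨k + 1, ?_⟩ ⟨k, p, e, h.toIsUniqueShortestPath, rfl⟩) <;>
  · rintro r ⟨l, q, f, hq, rfl⟩
    exact Nat.succ_le_succ (h.length_le l q f hq)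

lemma IsFiniteMultigraph.not_isLink_self {G : Graph α β} (hG : G.IsFiniteMultigraph) (e : β)
    (x : α) : ¬ G.IsLink e x x :=
  hG.loopless.not_isLoopAt e x

lemma IsFiniteMultigraph.hasSpectators {G : Graph α β} (hG : G.IsFiniteMultigraph) :
    G.HasSpectators G.spectatorNumber := by
  obtain ⟨k, p, e, h, hk⟩ := exists_paradeNumber_eq hG
  have hle := h.toIsPath.length_lt_ncard hG.finite_vertexSet
  refine ⟨hG.finite_vertexSet, hG.not_isLink_self, ?_⟩
  unfold spectatorNumber
  rw [hk]
  rcases k with _ | ℓ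
  · left
    omega
  · right
    obtain ⟨f, hf⟩ := h.exists_isLayout (by omega) hG.not_isLink_self
    exact ⟨ℓ, f, hf, by omega⟩

/-- A graph whose spectator floor is `k` has at most `k + 1` vertices or a layout with exactly `k`
spectators. -/
lemma exists_isLayout_of_spectatorFloor {G : Graph α β} (hG : G.IsFiniteMultigraph) :
    G.vertexSet.ncard ≤ G.spectatorFloor + 1 ∨
      ∃ ℓ f, G.IsLayout (ℓ + 1) f ∧ G.vertexSet.ncard = ℓ + 2 + G.spectatorFloor := by
  obtain ⟨γ, δ, H, hH, ⟨K, hK, hiso⟩, heq⟩ := exists_spectatorNumber_eq_spectatorFloor hG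
  rw [heq, hiso.ncard_vertexSet]
  rcases (hH.hasSpectators.of_reflTransGen hK).layout with h | ⟨ℓ, f, hf, h⟩
  · exact .inl h
  · obtain ⟨f', hf'⟩ := hiso.isLayout hf
    exact .inr ⟨ℓ, f', hf', h⟩

/-! ### Saturated layouts -/

/-- The largest number of parallel edges that vertices on the points `a` and `b` may have if at most
`m` parallel edges are allowed: none at distance more than `2`, one between even points, and `m`
otherwise. -/
def layoutCapacity (m a b : ℕ) : ℕ :=
  if a ≤ b + 2 ∧ b ≤ a + 2 then (if a % 2 = 0 ∧ b % 2 = 0 then 1 else m) else 0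

lemma layoutCapacity_comm (m a b : ℕ) : layoutCapacity m a b = layoutCapacity m b a := by
  unfold layoutCapacity
  split_ifs <;> omega

lemma layoutCapacity_le {m : ℕ} (hm : 1 ≤ m) (a b : ℕ) : layoutCapacity m a b ≤ m := by
  unfold layoutCapacity
  split_ifs <;> omega

lemma IsLayout.ncard_le_layoutCapacity {G : Graph α β} {ℓ m : ℕ} {f : α → ℕ}
    (h : G.IsLayout ℓ f) (hm : ∀ x y, {e | G.IsLink e x y}.ncard ≤ m) (x y : α) :
    {e | G.IsLink e x y}.ncard ≤ layoutCapacity m (f x) (f y) := by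
  unfold layoutCapacity
  split_ifs with h1 h2
  · have hs : {e | G.IsLink e x y}.Subsingleton := fun e he e' he' =>
      h.simple e e' x y he he' h2.1 h2.2
    have := hs.finite.to_subtype
    exact Set.ncard_le_one_iff_subsingleton.2 hs
  · exact hm x y
  · have : {e | G.IsLink e x y} = ∅ := Set.eq_empty_iff_forall_notMem.2 fun e he =>
      h1 ⟨h.link e x y he, h.link e y x he.symm⟩
    simp [this]

/-- A layout in which any two vertices are joined by as many edges as their positions permit. -/
structure IsSaturatedLayout (G : Graph α β) (ℓ m : ℕ) (f : α → ℕ) : Prop extends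
    G.IsLayout ℓ f where
  ncard_eq : ∀ x ∈ G.vertexSet, ∀ y ∈ G.vertexSet, x ≠ y →
    {e | G.IsLink e x y}.ncard = layoutCapacity m (f x) (f y)

/-- A layout of `G` is a saturated layout of any graph on the same vertices in which the numbers of
parallel edges are as large as the positions permit. -/
lemma IsLayout.isSaturatedLayout_of_ncard_eq {G : Graph α β} {H : Graph α δ} {ℓ m : ℕ} {f : α → ℕ}
    (h : G.IsLayout ℓ f) (hH : H.IsFiniteMultigraph) (hV : H.vertexSet = G.vertexSet)
    (hcard : ∀ x ∈ G.vertexSet, ∀ y ∈ G.vertexSet, x ≠ y →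
      {e | H.IsLink e x y}.ncard = layoutCapacity m (f x) (f y)) :
    H.IsSaturatedLayout ℓ m f := by
  have hcard' : ∀ e x y, H.IsLink e x y →
      {e | H.IsLink e x y}.ncard = layoutCapacity m (f x) (f y) := by
    intro e x y he
    refine hcard x (hV ▸ he.left_mem) y (hV ▸ he.right_mem) ?_
    rintro rfl
    exact hH.loopless.not_isLoopAt _ _ he
  have hfin : ∀ x y, {e | H.IsLink e x y}.Finite := fun x y =>
    hH.finite_edgeSet.subset fun e he => he.edge_mem
  refine ⟨⟨?_, ?_, ?_, fun e x y he => ?_, fun e e' x y he he' hx hy => ?_⟩, ?_⟩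
  · rw [hV]
    exact h.le
  · rw [hV]
    exact h.surj
  · rw [hV]
    exact h.inj
  · have h1 := hcard' e x y he
    have h2 := Set.ncard_ne_zero_of_mem (a := e) he (hfin x y)
    rw [h1] at h2
    unfold layoutCapacity at h2
    by_contra hlt
    exact h2 (if_neg fun h => hlt h.1)
  · have h1 := hcard' e x y he
    refine (Set.ncard_le_one (hfin x y)).1 ?_ e he e' he'
    rw [h1]
    unfold layoutCapacity
    split_ifs <;> omega
  · rw [hV]
    exact hcard

section Saturated

variable {G : Graph α β} {ℓ m : ℕ} {f : α → ℕ}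

lemma IsSaturatedLayout.adj (h : G.IsSaturatedLayout ℓ m f) (hm : 1 ≤ m) {x y : α}
    (hx : x ∈ G.vertexSet) (hy : y ∈ G.vertexSet) (hxy : x ≠ y) (h1 : f x ≤ f y + 2)
    (h2 : f y ≤ f x + 2) : G.Adj x y := by
  have hc := h.ncard_eq x hx y hy hxy
  have : {e | G.IsLink e x y}.ncard ≠ 0 := by
    rw [hc]
    unfold layoutCapacity
    split_ifs <;> omega
  exact Set.nonempty_of_ncard_ne_zero this

/-- The vertex on the point `2 * i` can be reached from any `x` to the left of it in
`i - ⌊f x / 2⌋` steps. -/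
lemma IsSaturatedLayout.exists_walk_even (h : G.IsSaturatedLayout ℓ m f) (hm : 1 ≤ m) {x : α}
    (hx : x ∈ G.vertexSet) (d : ℕ) : ∀ y ∈ G.vertexSet, f y % 2 = 0 → f x ≤ f y →
      f y / 2 = f x / 2 + d → ∃ W : G.toSimple.Walk x y, W.length = d := by
  induction d with
  | zero =>
    intro y hy hev hle hd
    obtain rfl := h.inj y hy x hx (by omega) hev
    exact ⟨.nil, rfl⟩
  | succ d ih =>
    intro y hy hev hle hd
    by_cases hnear : f y ≤ f x + 2 ∧ d = 0
    · obtain ⟨hnear, rfl⟩ := hnear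
      have hne : x ≠ y := by
        rintro rfl
        omega
      exact ⟨.cons ((h.adj hm hx hy hne (by omega) hnear).toSimple_adj hne) .nil, rfl⟩
    · have := h.le y hy
      obtain ⟨z, hz, hfz⟩ := h.surj (f y / 2 - 1) (by omega)
      obtain ⟨W, hW⟩ := ih z hz (by omega) (by omega) (by omega)
      have hne : z ≠ y := by
        rintro rfl
        omega
      exact ⟨W.concat ((h.adj hm hz hy hne (by omega) (by omega)).toSimple_adj hne), by
        rw [SimpleGraph.Walk.length_concat, hW]⟩

/-- The diameter of a saturated layout of length `ℓ` is at most `ℓ`. -/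
lemma IsSaturatedLayout.exists_walk_le (h : G.IsSaturatedLayout ℓ m f) (hm : 1 ≤ m) (hℓ : 1 ≤ ℓ)
    {x y : α} (hx : x ∈ G.vertexSet) (hy : y ∈ G.vertexSet) :
    ∃ W : G.toSimple.Walk x y, W.length ≤ ℓ := by
  wlog hle : f x ≤ f y generalizing x y
  · obtain ⟨W, hW⟩ := this hy hx (by omega)
    exact ⟨W.reverse, by simpa using hW⟩
  by_cases hxy : x = y
  · subst hxy
    exact ⟨.nil, Nat.zero_le _⟩
  have hly := h.le y hy
  by_cases hev : f y % 2 = 0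
  · obtain ⟨W, hW⟩ := h.exists_walk_even hm hx (f y / 2 - f x / 2) y hy hev hle (by omega)
    exact ⟨W, by omega⟩
  by_cases hnear : f y ≤ f x + 2
  · exact ⟨.cons ((h.adj hm hx hy hxy (by omega) hnear).toSimple_adj hxy) .nil, by simpa using hℓ⟩
  · obtain ⟨z, hz, hfz⟩ := h.surj (f y / 2) (by omega)
    have hne : z ≠ y := by
      rintro rfl
      omega
    obtain ⟨W, hW⟩ := h.exists_walk_even hm hx (f y / 2 - f x / 2) z hz (by omega) (by omega)
      (by omega)
    exact ⟨W.concat ((h.adj hm hz hy hne (by omega) (by omega)).toSimple_adj hne), by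
      rw [SimpleGraph.Walk.length_concat, hW]
      omega⟩

lemma IsSaturatedLayout.exists_path (h : G.IsSaturatedLayout ℓ m f) :
    ∃ (p : Fin (ℓ + 1) → α) (e : Fin ℓ → β), G.IsPath ℓ p e ∧ ∀ i, f (p i) = 2 * (i : ℕ) := by
  have hp : ∀ i : Fin (ℓ + 1), ∃ x ∈ G.vertexSet, f x = 2 * (i : ℕ) :=
    fun i => h.surj i (by omega)
  choose p hpV hfp using hp
  have hinj : Function.Injective p := by
    intro i j hij
    have := congrArg f hij
    rw [hfp, hfp] at this
    exact Fin.ext (by omega)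
  have hadj : ∀ i : Fin ℓ, G.Adj (p i.castSucc) (p i.succ) := by
    intro i
    have hne : p i.castSucc ≠ p i.succ := fun heq => by
      have := congrArg Fin.val (hinj heq)
      simp at this
    have hc := h.ncard_eq _ (hpV _) _ (hpV _) hne
    refine Set.nonempty_of_ncard_ne_zero (s := {e | G.IsLink e _ _}) ?_
    rw [hc, hfp, hfp]
    unfold layoutCapacity
    simp only [Fin.val_castSucc, Fin.val_succ]
    split_ifs <;> omega
  choose e he using hadj
  exact ⟨p, e, ⟨⟨hpV, he⟩, hinj⟩, hfp⟩

lemma IsLayout.position_le {G : Graph α β} {ℓ : ℕ} {f : α → ℕ} (h : G.IsLayout ℓ f) {l : ℕ}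
    {q : Fin (l + 1) → α} {g : Fin l → β} (hq : G.IsPath l q g) (i : Fin (l + 1)) :
    f (q i) ≤ f (q 0) + 2 * (i : ℕ) ∧ f (q (Fin.last l)) + 2 * (i : ℕ) ≤ f (q i) + 2 * l := by
  constructor
  · induction i using Fin.induction with
    | zero => simp
    | succ i ih =>
      have := h.link _ _ _ (hq.isLink i).symm
      simp only [Fin.val_castSucc, Fin.val_succ] at *
      omega
  · induction i using Fin.reverseInduction with
    | last => simp
    | cast i ih =>
      have := h.link _ _ _ (hq.isLink i).symm
      simp only [Fin.val_castSucc, Fin.val_succ] at *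
      omega

/-- The vertices on even points of a saturated layout form a parade: a path between the two ends
of the line moves by at most `2` in each step, so in `ℓ` steps it must use the even points, and the
diameter is `ℓ`. -/
lemma IsSaturatedLayout.isParade (h : G.IsSaturatedLayout ℓ m f) (hm : 1 ≤ m) (hℓ : 1 ≤ ℓ)
    {p : Fin (ℓ + 1) → α} {e : Fin ℓ → β} (hpath : G.IsPath ℓ p e)
    (hfp : ∀ i, f (p i) = 2 * (i : ℕ)) : G.IsParade ℓ p e := by
  classical
  refine ⟨⟨⟨hpath, fun l q g hq h0 h1 => ?_⟩, fun q g hq h0 h1 => ?_⟩, fun l q g hq => ?_⟩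
  · have := (h.position_le hq (Fin.last l)).1
    rw [h0, h1, hfp, hfp] at this
    simp at this
    omega
  · have hqp : q = p := by
      funext i
      have h2 := h.position_le hq i
      rw [h0, h1, hfp, hfp] at h2
      simp only [Fin.val_zero, Fin.val_last] at h2
      have h3 : f (q i) = 2 * (i : ℕ) := by omega
      exact h.inj _ (hq.vertex_mem i) _ (hpath.vertex_mem i) (by rw [h3, hfp]) (by omega)
    subst hqp
    refine ⟨rfl, funext fun i => ?_⟩
    exact h.simple _ _ _ _ (hq.isLink i) (hpath.isLink i) (by rw [hfp]; omega)
      (by rw [hfp]; omega)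
  · obtain ⟨W, hW⟩ := h.exists_walk_le hm hℓ (hq.vertex_mem 0) (hq.vertex_mem (Fin.last l))
    exact (hq.le_length_walk W).1.trans hW

lemma IsSaturatedLayout.paradeNumber_eq (h : G.IsSaturatedLayout ℓ m f) (hm : 1 ≤ m)
    (hℓ : 1 ≤ ℓ) : G.paradeNumber = ℓ + 1 := by
  obtain ⟨p, e, hpath, hfp⟩ := h.exists_path
  exact (h.isParade hm hℓ hpath hfp).paradeNumber_eq

lemma IsSaturatedLayout.isSaturatedCrowdedParade (h : G.IsSaturatedLayout ℓ m f) (hm : 1 ≤ m)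
    (hℓ : 1 ≤ ℓ) (hloop : ∀ g x, ¬ G.IsLink g x x) : G.IsSaturatedCrowdedParade m (ℓ + 1) := by
  obtain ⟨p, e, hpath, hfp⟩ := h.exists_path
  have hrange : ∀ x ∈ G.vertexSet, (x ∈ Set.range p ↔ f x % 2 = 0) := by
    intro x hx
    constructor
    · rintro ⟨i, rfl⟩
      rw [hfp]
      omega
    · intro hev
      have := h.le x hx
      refine ⟨⟨f x / 2, by omega⟩, h.inj _ (hpath.vertex_mem _) _ hx ?_ ?_⟩ <;> rw [hfp] <;>
        dsimp only <;> omega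
  have hlink : ∀ {x y}, G.Adj x y → f x ≤ f y + 2 ∧ f y ≤ f x + 2 := by
    rintro x y ⟨g, hg⟩
    exact ⟨h.link _ _ _ hg, h.link _ _ _ hg.symm⟩
  refine .inl ⟨by omega, ℓ, p, e, rfl, ⟨h.isParade hm hℓ hpath hfp, ?_, ?_⟩, ?_⟩
  · intro w hw hwp
    rw [hrange w hw] at hwp
    have hlw := h.le w hw
    have hne : ∀ i, w ≠ p i := by
      rintro i rfl
      rw [hfp] at hwp
      omega
    refine ⟨p ⟨f w / 2, by omega⟩, ⟨_, rfl⟩, p ⟨f w / 2 + 1, by omega⟩, ⟨_, rfl⟩, ?_, ?_, ?_⟩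
    · intro heq
      simpa using congrArg Fin.val (hpath.injective heq)
    · refine h.adj hm (hpath.vertex_mem _) (hpath.vertex_mem _) ?_ ?_ ?_
      · intro heq
        simpa using congrArg Fin.val (hpath.injective heq)
      all_goals rw [hfp, hfp]; dsimp only; omega
    · rintro z ⟨i, rfl⟩
      constructor
      · intro hadj
        have := hlink hadj
        rw [hfp] at this
        rcases (by omega : (i : ℕ) = f w / 2 ∨ (i : ℕ) = f w / 2 + 1) with hi | hi
        · exact .inl (congrArg p (Fin.ext hi))
        · exact .inr (congrArg p (Fin.ext hi))
      · rintro (heq | heq) <;> have hi := congrArg Fin.val (hpath.injective heq) <;>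
          dsimp only at hi <;>
          refine h.adj hm hw (hpath.vertex_mem _) (hne i) ?_ ?_ <;> rw [hfp] <;> omega
  · rintro w hw w' hw' hwp hwp' hne ⟨z, ⟨i, rfl⟩, h1, h2⟩
    rw [hrange w hw] at hwp
    rw [hrange w' hw'] at hwp'
    have h1 := hlink h1
    have h2 := hlink h2
    rw [hfp] at h1 h2
    exact h.adj hm hw hw' hne (by omega) (by omega)
  · intro g hg x y hxy
    have hne : x ≠ y := by
      rintro rfl
      exact hloop _ _ hxy
    have h1 := h.link _ _ _ hxy
    have h2 := h.link _ _ _ hxy.symm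
    rw [h.ncard_eq x hxy.left_mem y hxy.right_mem hne]
    unfold layoutCapacity
    rw [if_pos ⟨h1, h2⟩, if_neg]
    rintro ⟨hx, hy⟩
    obtain ⟨i, rfl⟩ := (hrange x hxy.left_mem).2 hx
    obtain ⟨j, rfl⟩ := (hrange y hxy.right_mem).2 hy
    -- An edge joining two vertices of the parade belongs to the parade.
    have key : ∀ i j : Fin (ℓ + 1), (j : ℕ) = i + 1 → ¬ G.IsLink g (p i) (p j) := by
      intro i j hij hl
      have hi : (⟨i, by omega⟩ : Fin ℓ).castSucc = i := rfl
      have hj : (⟨i, by omega⟩ : Fin ℓ).succ = j := Fin.ext (by simp [hij])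
      refine hg ⟨⟨i, by omega⟩, h.simple _ _ (p i) (p j) ?_ hl (by rw [hfp]; omega)
        (by rw [hfp]; omega)⟩
      have := hpath.isLink ⟨i, by omega⟩
      rwa [hi, hj] at this
    rw [hfp, hfp] at h1 h2
    rcases Nat.lt_trichotomy i j with h3 | h3 | h3
    · exact key i j (by omega) hxy
    · exact hne (congrArg p (Fin.ext h3))
    · exact key j i (by omega) hxy.symm

end Saturated

/-- If any two vertices are joined by several edges or by none, a unique shortest path has only one
vertex. -/
lemma paradeNumber_eq_one {G : Graph α β} (hG : G.IsFiniteMultigraph)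
    (h : ∀ e x y, G.IsLink e x y → 2 ≤ {g | G.IsLink g x y}.ncard) : G.paradeNumber = 1 := by
  obtain ⟨k, p, e, hp, hk⟩ := exists_paradeNumber_eq hG
  rcases k with _ | k
  · exact hk
  have h2 := h _ _ _ (hp.isLink 0)
  obtain ⟨g, hg, hne⟩ := Set.exists_ne_of_one_lt_ncard h2 (e 0)
  exact (hne (hp.eq_of_isLink 0 hg)).elim

/-! ### Adding parallel edges -/

/-- The graph `G` with `s x y` new edges for all vertices `x`, `y` with `c x < c y`, where `c`
numbers the vertices. The new edge named `(i, j, t)` is the `t`-th one joining the vertices with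
the numbers `i` and `j`. -/
def addEdges (G : Graph α β) (c : α → ℕ) (hc : Set.InjOn c G.vertexSet) (s : α → α → ℕ) :
    Graph α (β ⊕ ULift.{v} (ℕ × ℕ × ℕ)) where
  vertexSet := G.vertexSet
  IsLink e x y := match e with
    | .inl e => G.IsLink e x y
    | .inr ⟨i, j, t⟩ => x ∈ G.vertexSet ∧ y ∈ G.vertexSet ∧ i < j ∧
        (i = c x ∧ j = c y ∧ t < s x y ∨ i = c y ∧ j = c x ∧ t < s y x)
  isLink_symm := by
    rintro (e | ⟨i, j, t⟩) - <;> refine ⟨fun x y h => ?_⟩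
    · exact IsLink.symm h
    · exact ⟨h.2.1, h.1, h.2.2.1, h.2.2.2.symm⟩
  eq_or_eq_of_isLink_of_isLink := by
    rintro (e | ⟨i, j, t⟩) x y z w h h'
    · exact IsLink.left_eq_or_eq h h'
    · obtain ⟨hx, hy, -, h⟩ := h
      obtain ⟨hz, hw, -, h'⟩ := h'
      have : c x = c z ∨ c x = c w := by omega
      exact this.imp (hc hx hz) (hc hx hw)
  left_mem_of_isLink := by
    rintro (e | ⟨i, j, t⟩) x y h
    · exact IsLink.left_mem h
    · exact h.1

section AddEdges

variable {G : Graph α β} {c : α → ℕ} {hc : Set.InjOn c G.vertexSet} {s : α → α → ℕ}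

lemma addEdges_isLink_inl {e : β} {x y : α} :
    (G.addEdges c hc s).IsLink (.inl e) x y ↔ G.IsLink e x y := Iff.rfl

lemma addEdges_isLink_inr {i j t : ℕ} {x y : α} :
    (G.addEdges c hc s).IsLink (.inr ⟨i, j, t⟩) x y ↔ x ∈ G.vertexSet ∧ y ∈ G.vertexSet ∧ i < j ∧
        (i = c x ∧ j = c y ∧ t < s x y ∨ i = c y ∧ j = c x ∧ t < s y x) := Iff.rfl

lemma IsFiniteMultigraph.addEdges (hG : G.IsFiniteMultigraph) :
    (G.addEdges c hc s).IsFiniteMultigraph := by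
  refine ⟨hG.nonempty, hG.finite_vertexSet, ?_, ⟨?_⟩⟩
  · have hfin : (⋃ x ∈ G.vertexSet, ⋃ y ∈ G.vertexSet,
        (fun t => (Sum.inr ⟨c x, c y, t⟩ : β ⊕ ULift.{v} (ℕ × ℕ × ℕ))) '' Set.Iio (s x y)).Finite :=
      hG.finite_vertexSet.biUnion fun x _ => hG.finite_vertexSet.biUnion fun y _ =>
        (Set.finite_Iio _).image _
    refine ((hG.finite_edgeSet.image Sum.inl).union hfin).subset ?_
    rintro (e | ⟨i, j, t⟩) he
    · obtain ⟨x, y, h⟩ := exists_isLink_of_mem_edgeSet he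
      exact .inl ⟨e, (addEdges_isLink_inl.1 h).edge_mem, rfl⟩
    · obtain ⟨x, y, h⟩ := exists_isLink_of_mem_edgeSet he
      obtain ⟨hx, hy, -, ⟨rfl, rfl, ht⟩ | ⟨rfl, rfl, ht⟩⟩ := addEdges_isLink_inr.1 h <;> right <;>
        simp only [Set.mem_iUnion]
      · exact ⟨x, hx, y, hy, t, ht, rfl⟩
      · exact ⟨y, hy, x, hx, t, ht, rfl⟩
  · rintro (e | ⟨i, j, t⟩) x h
    · exact hG.not_isLink_self e x h
    · obtain ⟨-, -, hij, h⟩ := addEdges_isLink_inr.1 h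
      omega

lemma ncard_addEdges (hG : G.IsFiniteMultigraph) (hs : ∀ x y, s x y = s y x) {x y : α}
    (hx : x ∈ G.vertexSet) (hy : y ∈ G.vertexSet) (hxy : x ≠ y) :
    {e | (G.addEdges c hc s).IsLink e x y}.ncard = {e | G.IsLink e x y}.ncard + s x y := by
  have hcne : c x ≠ c y := fun h => hxy (hc hx hy h)
  wlog hlt : c x < c y generalizing x y
  · have h := this hy hx hxy.symm hcne.symm (by omega)
    simp only [isLink_comm (x := y) (y := x), hs y x] at h
    exact h
  have hset : {e | (G.addEdges c hc s).IsLink e x y} = Sum.inl '' {e | G.IsLink e x y} ∪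
      (fun t => Sum.inr ⟨c x, c y, t⟩) '' Set.Iio (s x y) := by
    ext (e | ⟨i, j, t⟩)
    · simp [addEdges_isLink_inl]
    · simp only [Set.mem_ofPred_eq, addEdges_isLink_inr, Set.mem_union, Set.mem_image,
        reduceCtorEq, and_false, exists_false, false_or, Set.mem_Iio, Sum.inr.injEq,
        ULift.up.injEq, Prod.mk.injEq]
      constructor
      · rintro ⟨-, -, hij, ⟨rfl, rfl, ht⟩ | ⟨rfl, rfl, ht⟩⟩
        · exact ⟨t, ht, rfl, rfl, rfl⟩
        · omega
      · rintro ⟨t, ht, rfl, rfl, rfl⟩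
        exact ⟨hx, hy, hlt, .inl ⟨rfl, rfl, ht⟩⟩
  have hfin : {e | G.IsLink e x y}.Finite := hG.finite_edgeSet.subset fun e he => he.edge_mem
  rw [hset, Set.ncard_union_eq ?_ (hfin.image _) ((Set.finite_Iio _).image _),
    Set.ncard_image_of_injective _ Sum.inl_injective, Set.ncard_image_of_injective]
  · simp
  · intro t t' h
    simpa using h
  · rw [Set.disjoint_left]
    rintro _ ⟨e, -, rfl⟩ ⟨t, -, h⟩
    simp at h

lemma isIsomorphic_deleteEdges_addEdges :
    G.IsIsomorphic ((G.addEdges c hc s).deleteEdges (Set.range Sum.inr)) := by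
  refine ⟨Equiv.refl _, ⟨fun e => ⟨.inl e, ?_, by simp⟩,
    fun e => match e with
      | ⟨.inl e, he⟩ => ⟨e, ?_⟩
      | ⟨.inr t, he⟩ => (he.2 ⟨t, rfl⟩).elim, ?_, ?_⟩, ?_⟩
  · obtain ⟨x, y, h⟩ := exists_isLink_of_mem_edgeSet e.2
    exact (addEdges_isLink_inl (c := c) (hc := hc) (s := s).2 h).edge_mem
  · obtain ⟨x, y, h⟩ := exists_isLink_of_mem_edgeSet he.1
    exact (addEdges_isLink_inl.1 h).edge_mem
  · intro e
    rfl
  · rintro ⟨e | t, he⟩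
    · rfl
    · exact (he.2 ⟨t, rfl⟩).elim
  · intro e x y
    simp only [deleteEdges_isLink, Equiv.coe_fn_mk, addEdges_isLink_inl, Set.mem_range,
      reduceCtorEq, exists_false, not_false_eq_true, and_true]
    rfl

end AddEdges

/-! ### Saturation of a minor-maximal graph -/

/-- Let `M x y ≤ m` bound the number of edges of `G` joining `x` and `y`, and suppose that the
parade number is `n - k` for every graph on the vertices of `G` that attains all these bounds.
Adding edges to `G` until the bounds are attained then stays in the class, so a minor-maximal `G`
attains them. -/
lemma IsMinorMaximal.ncard_eq {G : Graph α β} {n m k : ℕ} (hG : G.IsMinorMaximal n m k)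
    (hk : k < n) {M : α → α → ℕ} (hM : ∀ x y, M x y = M y x) (hMm : ∀ x y, M x y ≤ m)
    (hGM : ∀ x y, {e | G.IsLink e x y}.ncard ≤ M x y)
    (hparade : ∀ (δ : Type v) (H : Graph α δ), H.IsFiniteMultigraph → H.vertexSet = G.vertexSet →
      (∀ x ∈ G.vertexSet, ∀ y ∈ G.vertexSet, x ≠ y → {e | H.IsLink e x y}.ncard = M x y) →
      H.paradeNumber = n - k) {x y : α} (hx : x ∈ G.vertexSet) (hy : y ∈ G.vertexSet)
    (hxy : x ≠ y) : {e | G.IsLink e x y}.ncard = M x y := by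
  obtain ⟨⟨hfin, hn, hm, hfloor⟩, hmax⟩ := hG
  obtain ⟨c, hc⟩ := Set.countable_iff_exists_injOn.1 hfin.finite_vertexSet.countable
  set s : α → α → ℕ := fun x y => M x y - {e | G.IsLink e x y}.ncard with hsdef
  have hs : ∀ x y, s x y = s y x := by
    intro x y
    simp only [hsdef, hM x y, isLink_comm (x := x) (y := y)]
  set H := G.addEdges c hc s with hH
  have hHfin : H.IsFiniteMultigraph := hfin.addEdges
  have hHV : H.vertexSet = G.vertexSet := rfl
  have hcard : ∀ x ∈ G.vertexSet, ∀ y ∈ G.vertexSet, x ≠ y →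
      {e | H.IsLink e x y}.ncard = M x y := by
    intro x hx y hy hxy
    rw [hH, ncard_addEdges hfin hs hx hy hxy]
    have := hGM x y
    simp only [hsdef]
    omega
  have hiso : G.IsIsomorphic (H.deleteEdges (Set.range Sum.inr)) :=
    isIsomorphic_deleteEdges_addEdges
  have hle : G.spectatorFloor ≤ H.spectatorFloor := spectatorFloor_le_of_deleteEdges hiso hHfin
  have hge : H.spectatorFloor ≤ H.spectatorNumber := spectatorFloor_le hHfin (.refl H)
  have hspec : H.spectatorNumber = k := by
    unfold spectatorNumber
    rw [hparade _ H hHfin hHV hcard, hHV, hn]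
    omega
  have hclass : H.InClass n m k := by
    refine ⟨hHfin, hn, fun x y => ?_, by omega⟩
    by_cases h : ∃ e, H.IsLink e x y
    · obtain ⟨e, he⟩ := h
      have hxy : x ≠ y := by
        rintro rfl
        exact hHfin.not_isLink_self e x he
      rw [hcard x he.left_mem y he.right_mem hxy]
      exact hMm x y
    · have : {e | H.IsLink e x y} = ∅ := Set.eq_empty_iff_forall_notMem.2 fun e he => h ⟨e, he⟩
      simp [this]
  have hminor : G.IsMinorOf H :=
    IsMinorOf.of_deleteEdges hiso hHfin.finite_edgeSet (.refl H)
  -- As `G` and `H` are isomorphic, they have the same number of edges, so no edge was added.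
  have hE := (hmax α _ H hclass hminor).ncard_edgeSet
  rw [hiso.ncard_edgeSet] at hE
  have hEeq : (H.deleteEdges (Set.range Sum.inr)).edgeSet = H.edgeSet :=
    Set.eq_of_subset_of_ncard_le deleteEdges_le.edgeSet_mono hE.ge hHfin.finite_edgeSet
  have h0 : s x y = 0 := by
    by_contra hne
    have hcne : c x ≠ c y := fun h => hxy (hc hx hy h)
    have hmem : ∃ t, Sum.inr t ∈ H.edgeSet := by
      rcases Nat.lt_or_gt_of_ne hcne with hlt | hlt
      · exact ⟨⟨c x, c y, 0⟩, IsLink.edge_mem (x := x) (y := y) (addEdges_isLink_inr.2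
          ⟨hx, hy, hlt, .inl ⟨rfl, rfl, Nat.pos_of_ne_zero hne⟩⟩)⟩
      · exact ⟨⟨c y, c x, 0⟩, IsLink.edge_mem (x := x) (y := y) (addEdges_isLink_inr.2
          ⟨hx, hy, hlt, .inr ⟨rfl, rfl, Nat.pos_of_ne_zero (by rwa [hs])⟩⟩)⟩
    obtain ⟨t, ht⟩ := hmem
    rw [← hEeq] at ht
    exact ht.2 ⟨t, rfl⟩
  have := hGM x y
  simp only [hsdef] at h0
  omega

end Graph

open Graph in
theorem mainTheorem5 {α β : Type*} (G : Graph α β) (n m k : ℕ)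
    (hkm : (k + 2 ≤ n ∧ 1 ≤ m) ∨ (k + 1 = n ∧ 2 ≤ m))
    (hG : G.IsMinorMaximal n m k) :
    G.IsSaturatedCrowdedParade m (n - k) := by
  obtain ⟨hfin, hn, hm, hfloor⟩ := hG.1
  rcases hkm with ⟨hk, hm1⟩ | ⟨hk, hm2⟩
  · rcases exists_isLayout_of_spectatorFloor hfin with h | ⟨ℓ, f, hf, hV⟩
    · omega
    have hnk : n - k = ℓ + 1 + 1 := by omega
    have hsat : G.IsSaturatedLayout (ℓ + 1) m f := ⟨hf, fun x hx y hy hxy =>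
      hG.ncard_eq (by omega) (M := fun x y => layoutCapacity m (f x) (f y))
        (fun _ _ => layoutCapacity_comm _ _ _) (fun _ _ => layoutCapacity_le hm1 _ _)
        (hf.ncard_le_layoutCapacity hm) (fun δ H hH hHV hcard => by
          rw [hnk]
          exact (hf.isSaturatedLayout_of_ncard_eq hH hHV hcard).paradeNumber_eq hm1 (by omega))
        hx hy hxy⟩
    rw [hnk]
    exact hsat.isSaturatedCrowdedParade hm1 (by omega) hfin.not_isLink_self
  · refine .inr ⟨by omega, fun x hx y hy hxy => hG.ncard_eq (by omega) (M := fun _ _ => m)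
      (fun _ _ => rfl) (fun _ _ => le_rfl) hm (fun δ H hH hHV hcard => ?_) hx hy hxy⟩
    rw [paradeNumber_eq_one hH fun e x y he => ?_]
    · omega
    · rw [hcard x (hHV ▸ he.left_mem) y (hHV ▸ he.right_mem)]
      · exact hm2
      · rintro rfl
        exact hH.not_isLink_self _ _ he
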